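/- **Model.** There are $n>2$ processes $0,\dots,n-1$ and a bound $1\le f<n$ on the number of crashes. Computation is synchronous, round $m+1$ taking place between times $m$ and $m+1$. In round $m+1$ a process with a given local state at time $m$ (its initial value in $\{0,1\}$, the time, and everything it has received so far) deterministically sends at most one message to each process, may take a decision (said to be taken at time $m$) before, between or after these sends, and then receives the messages sent to it in this round. A process crashing in round $m$ behaves correctly in earlier rounds and does nothing in later rounds. In the context $\gamma^f$ at most $f$ processes crash, and a crashing process sends an arbitrary subset of the messages prescribed for its crashing round. In the context $\tilde\gamma^f$, in addition, if a process crashes in a round in which a decision is prescribed, then it takes the decision only if all messages that it is to send before the decision in that round have been sent, and if it does not take the decision then no message that is to be sent after the decision is sent. Messages of a process to itself are not sent over the network and not counted. A run is *nice* if all initial values are $1$ and no process crashes. A protocol *solves atomic commitment* (AC) in a context if all its runs satisfy: every correct process eventually decides $\mathsf{commit}$ or $\mathsf{abort}$ (Decision); all decisions are equal (Agreement); if some process commits then all initial values are $1$ (Commit Validity); if some process aborts then some initial value is $0$ or some process crashes (Abort Validity). A *biased-to-1 uniform consensus* protocol with tolerance $t$ decides on values in $\{0,1\}$. In every run of $\gamma^f$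 a value is decided only if it is some process's initial value (Validity), and every correct process eventually decides (Decision). In every run of $\gamma^f$ in which at most $t$ processes crash other than in the first round without sending any message, all decisions are equal (Agreement), and if some correct process has initial value $1$ then only $1$ is decided (Biased-to-1). **The 1.5D protocol**, for a biased-to-1 uniform consensus protocol $C$ with tolerance $f-1$ (all processes $i$; "all" includes $i$ itself). *Round 1:* if $v_i=1$, send '1' to all. *Round 2:* if '1' was received from all in round 1, send $\mathtt{all[1]}$ to $i+1,\dots,i+f \pmod n$ and then $\mathsf{commit}$; otherwise send 'huh?' to all. *From round 3 on:* if no 'huh?' was received in round 2, halt. Otherwise run $C$ with initial value $1$ if $i$ received $\mathtt{all[1]}$ or committed, and with initial value $0$ otherwise; if $i$ has not committed, then it commits when $C$ decides $1$ and aborts when $C$ decides $0$. **Claim.** Let $n>2$ and $1\le f<n$. 1. Biased-to-1 uniform consensus protocols with tolerance $f-1$ exist. 2. With any such protocol $C$, the 1.5D protocol solves AC in $\tilde\gamma^f$; in its nice runs every process commits at time $1$ (in the middle of round 2) and takes no other decision, and exactly $n^2+nf-n$ messages are sent. 3. This is optimal if $f>1$: if a protocol solves AC in $\tilde\gamma^f$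 and all processes commit before time $2$ in its nice runs, then at least $n^2+nf-n$ messages are sent in each of its nice runs. -/

import Mathlib

namespace SyncCrash

/-! ### The synchronous message-passing model with crash failures -/

/-- What a process is about to do at time `m` (that is, in round `m + 1`), besides receiving.
It sends at most one message to each process, and possibly takes a decision; `early` lists the
recipients whose messages are sent before the decision, the other messages being sent after it.
If no decision is taken, `early` has no meaning. -/
structure Action (n : ℕ) (M D : Type*) where
  send : Fin n → Option M
  decide : Option D
  early : Finset (Fin n)

/-- Doing nothing in a round. -/
def Action.silent {n : ℕ} {M D : Type*} : Action n M D := ⟨fun _ => none, none, ∅⟩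

/-- The local state of a process at time `m`: its initial value and, for each of the rounds
`1, …, m` in this order, the messages received from each process in that round. The current time
is the length of the list; the process's own past actions are determined by these data, since
protocols are deterministic. -/
structure LocalState (n : ℕ) (I M : Type*) where
  input : I
  received : List (Fin n → Option M)

/-- A deterministic protocol: every process acts as a function of its local state.
`I` is the type of initial values, `M` of messages, `D` of decisions. -/
abbrev Protocol (n : ℕ) (I M D : Type*) := Fin n → LocalState n I M → Action n M D

/-- A crash in round `time + 1`: in that round only the messages prescribed to processes in
`reached` are sent, and the decision prescribed at time `time` (if any) is taken
iff `decides = true`. -/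
structure Crash (n : ℕ) where
  time : ℕ
  reached : Finset (Fin n)
  decides : Bool

/-- As protocols are deterministic, a run is determined by the initial values and the crashes. -/
structure Run (n : ℕ) (I : Type*) where
  input : Fin n → I
  crash : Fin n → Option (Crash n)

/-- The messages actually sent at time `m` by a process that is to perform `a`. -/
def transmit {n : ℕ} {M D : Type*} (c : Option (Crash n)) (m : ℕ) (a : Action n M D) :
    Fin n → Option M := fun j =>
  match c with
  | none => a.send j
  | some c => if m < c.time ∨ (m = c.time ∧ j ∈ c.reached) then a.send j else none

variable {n : ℕ} {I M D : Type*}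

/-- The local state of each process at time `m`. (For a crashed process this is a formal value,
which influences nothing, as the process no longer acts.) -/
def state (P : Protocol n I M D) (r : Run n I) : ℕ → Fin n → LocalState n I M
  | 0, i => ⟨r.input i, []⟩
  | m + 1, j => ⟨r.input j, (state P r m j).received ++
      [fun i => transmit (r.crash i) m (P i (state P r m i)) j]⟩

/-- The message sent from `i` to `j` in round `m + 1`, if any. -/
def sent (P : Protocol n I M D) (r : Run n I) (m : ℕ) (i j : Fin n) : Option M :=
  transmit (r.crash i) m (P i (state P r m i)) j

/-- Process `i` takes the decision `d` at time `m`. -/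
def Decides (P : Protocol n I M D) (r : Run n I) (i : Fin n) (m : ℕ) (d : D) : Prop :=
  (P i (state P r m i)).decide = some d ∧
    ∀ c, r.crash i = some c → m < c.time ∨ (m = c.time ∧ c.decides = true)

def Faulty (r : Run n I) (i : Fin n) : Prop := r.crash i ≠ none

/-- The process crashes in the first round, before sending anything. -/
def InitiallyDead (r : Run n I) (i : Fin n) : Prop :=
  ∃ c, r.crash i = some c ∧ c.time = 0 ∧ c.reached = ∅

/-- The context `γ^f`: at most `f` processes crash. A crashing process sends an arbitrary subset
of the messages prescribed for its crashing round. -/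
def InGamma (f : ℕ) (r : Run n I) : Prop := {i | Faulty r i}.ncard ≤ f

/-- The context `γ̃^f`: at most `f` processes crash, and in its crashing round a process performs
its actions in order: if it takes a decision then all the messages to be sent before the decision
have been sent, and if it does not get to take the prescribed decision then none of the messages
to be sent after the decision is sent. -/
def InGammaTilde (P : Protocol n I M D) (f : ℕ) (r : Run n I) : Prop :=
  InGamma f r ∧
  ∀ i c, r.crash i = some c → (P i (state P r c.time i)).decide ≠ none →
    (c.decides = true → ∀ j ∈ (P i (state P r c.time i)).early,
      (P i (state P r c.time i)).send j ≠ none → j ∈ c.reached) ∧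
    (c.decides = false → ∀ j ∈ c.reached,
      (P i (state P r c.time i)).send j ≠ none → j ∈ (P i (state P r c.time i)).early)

/-- The number of messages sent over the network in a run (messages from a process to itself
are not sent over the network). -/
noncomputable def messageCount (P : Protocol n I M D) (r : Run n I) : ℕ∞ :=
  {x : ℕ × Fin n × Fin n | x.2.1 ≠ x.2.2 ∧ sent P r x.1 x.2.1 x.2.2 ≠ none}.encard

/-! ### Atomic commitment -/

inductive ACDecision
  | commit
  | abort

open ACDecision

/-- The four requirements of atomic commitment on a run; `true` is the initial value 1. -/
structure SatisfiesAC (P : Protocol n Bool M ACDecision) (r : Run n Bool) : Prop where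
  decision : ∀ i, ¬ Faulty r i → ∃ m d, Decides P r i m d
  agreement : ∀ i i' m m' d d', Decides P r i m d → Decides P r i' m' d' → d = d'
  commit_validity : ∀ i m, Decides P r i m commit → ∀ j, r.input j = true
  abort_validity : ∀ i m, Decides P r i m abort → (∃ j, r.input j = false) ∨ ∃ j, Faulty r j

/-- `P` is an AC protocol in the context `γ̃^f`. -/
def SolvesAC (f : ℕ) (P : Protocol n Bool M ACDecision) : Prop :=
  ∀ r, InGammaTilde P f r → SatisfiesAC P r

/-- A nice run: all initial values are 1 and no failure occurs. -/
def Nice (r : Run n Bool) : Prop := (∀ i, r.input i = true) ∧ ∀ i, ¬ Faulty r i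

/-! ### Biased-to-1 uniform consensus -/

/-- Biased-to-1 uniform consensus in `γ^f` with tolerance `t`. Validity and Decision hold in all
runs of `γ^f`; Agreement and Biased-to-1 are only required in those runs in which at most `t`
processes crash after having started (the others that crash, if any, never send a message).
For `t ≥ f` this says that all four conditions hold in all runs of `γ^f`. -/
structure IsB1Consensus (f t : ℕ) (C : Protocol n Bool M Bool) : Prop where
  validity : ∀ r, InGamma f r → ∀ i m b, Decides C r i m b → ∃ j, r.input j = b
  decision : ∀ r, InGamma f r → ∀ i, ¬ Faulty r i → ∃ m b, Decides C r i m b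
  agreement : ∀ r, InGamma f r → {i | Faulty r i ∧ ¬ InitiallyDead r i}.ncard ≤ t →
    ∀ i i' m m' b b', Decides C r i m b → Decides C r i' m' b' → b = b'
  biased : ∀ r, InGamma f r → {i | Faulty r i ∧ ¬ InitiallyDead r i}.ncard ≤ t →
    (∃ j, ¬ Faulty r j ∧ r.input j = true) → ∀ i m b, Decides C r i m b → b = true

/-! ### The 1.5D protocol -/

/-- The messages `1`, `all[1]`, `huh?`, and those of the consensus protocol. -/
inductive Msg (μ : Type*)
  | one
  | allOnes
  | huh
  | cons (x : μ)

namespace Msg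

variable {μ : Type*}

def isOne : Msg μ → Bool
  | one => true
  | _ => false

def isAllOnes : Msg μ → Bool
  | allOnes => true
  | _ => false

def isHuh : Msg μ → Bool
  | huh => true
  | _ => false

def toCons : Msg μ → Option μ
  | cons x => some x
  | _ => none

end Msg

/-- The protocol 1.5D for `n` processes and at most `f` failures, with consensus subroutine `C`.
"All" includes the sender itself. In round 2 the messages `all[1]` are sent before committing.
From round 3 on, a process that received `huh?` in round 2 runs `C` (whose time `0` is
time `2`), and adopts its decision unless it committed in round 2. -/
def protocol15D (n f : ℕ) {μ : Type*} (C : Protocol n Bool μ Bool) :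
    Protocol n Bool (Msg μ) ACDecision := fun i s =>
  match s.received with
  | [] =>
      if s.input = true then ⟨fun _ => some Msg.one, none, ∅⟩ else Action.silent
  | [r₁] =>
      if ∀ j, (r₁ j).any Msg.isOne = true then
        ⟨fun j => if ∃ k : Fin f, (j : ℕ) = ((i : ℕ) + ((k : ℕ) + 1)) % n
            then some Msg.allOnes else none,
          some commit, Finset.univ⟩
      else ⟨fun _ => some Msg.huh, none, ∅⟩
  | r₁ :: r₂ :: rs =>
      if ∀ j, (r₂ j).any Msg.isHuh = false then Action.silent
      else
        let committed : Bool := decide (∀ j, (r₁ j).any Msg.isOne = true)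
        let vhat : Bool := committed || decide (∃ j, (r₂ j).any Msg.isAllOnes = true)
        let a := C i ⟨vhat, rs.map fun r j => (r j).bind Msg.toCons⟩
        ⟨fun j => (a.send j).map Msg.cons,
          if committed = true then none
            else a.decide.map fun b => if b = true then commit else abort,
          ∅⟩

end SyncCrash

universe u

namespace SyncCrash

variable {n : ℕ} {I M D : Type*}

open ACDecision

/-! ### Basic facts on states and transmissions -/

/-! Upper bound. If some process does not hear '1' from all although all initial values are 1, then
some process crashed in round 1. Seen from time 2, where `C` starts, that process is initially dead,
so at most `f - 1` other crashes count and tolerance `f - 1` suffices. A process that commits at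
time 1 has already sent `all[1]` to `f` others. Hence `f + 1` processes would enter `C` with value
1, one of them is correct, and the bias of `C` forces 1. If some initial value is 0, nobody hears
'1' from all, every input of `C` is 0, and validity alone forces 0. Once a process without all the
'1's completes round 2, its 'huh?' reaches everybody, so all surviving processes run `C` and 1.5D
simulates it faithfully (`state_consensusRun`). `C` itself is obtained by flooding the value 1 for
`f` rounds (`isB1Consensus_floodOnes`).

Lower bound. Both rounds use indistinguishable runs. A process that commits at time 1 must have
heard from every other process, since a silent one might have had value 0: this gives `n * (n - 1)`
messages. In round 2 it must send at least `f` messages before its commit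
(`le_card_earlyRecipients`). With fewer, crashing the committer and all these recipients, as well as
a process `j` heard of in round 1 by the committer only, hides the commit from a survivor. The
survivor cannot tell whether `j` had value 0. -/

theorem length_received (P : Protocol n I M D) (r : Run n I) (m : ℕ) (i : Fin n) :
    (state P r m i).received.length = m := by
  induction m with
  | zero => rfl
  | succ m ih => simp [state, ih]

theorem input_state (P : Protocol n I M D) (r : Run n I) (m : ℕ) (i : Fin n) :
    (state P r m i).input = r.input i := by
  cases m <;> rfl

theorem state_succ (P : Protocol n I M D) (r : Run n I) (m : ℕ) (j : Fin n) :
    state P r (m + 1) j =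
      ⟨r.input j, (state P r m j).received ++ [fun i => sent P r m i j]⟩ := rfl

/-- Process `i` has not crashed before it has completed the sends of round `m + 1`. -/
def CompletesRound (r : Run n I) (m : ℕ) (i : Fin n) : Prop :=
  ∀ c, r.crash i = some c → m < c.time

theorem transmit_of_lt {c : Option (Crash n)} {m : ℕ} (h : ∀ d, c = some d → m < d.time)
    (a : Action n M D) (j : Fin n) : transmit c m a j = a.send j := by
  cases c with
  | none => rfl
  | some d => simp [transmit, h d rfl]

theorem sent_of_completesRound (P : Protocol n I M D) {r : Run n I} {m : ℕ} {i : Fin n}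
    (h : CompletesRound r m i) (j : Fin n) :
    sent P r m i j = (P i (state P r m i)).send j :=
  transmit_of_lt h _ j

theorem completesRound_of_not_faulty {r : Run n I} {i : Fin n} (h : ¬ Faulty r i) (m : ℕ) :
    CompletesRound r m i :=
  fun c hc => absurd (fun h0 => Option.some_ne_none c (hc.symm.trans h0)) h

theorem sent_of_not_faulty (P : Protocol n I M D) {r : Run n I} {i : Fin n}
    (h : ¬ Faulty r i) (m : ℕ) (j : Fin n) :
    sent P r m i j = (P i (state P r m i)).send j :=
  sent_of_completesRound P (completesRound_of_not_faulty h m) j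

theorem send_ne_none_of_sent_ne_none {P : Protocol n I M D} {r : Run n I} {m : ℕ} {i j : Fin n}
    (h : sent P r m i j ≠ none) : (P i (state P r m i)).send j ≠ none := by
  intro h'
  apply h
  unfold sent transmit
  split
  · exact h'
  · split_ifs
    exacts [h', rfl]

theorem send_eq_of_sent_eq {P : Protocol n I M D} {r : Run n I} {m : ℕ} {i j : Fin n} {x : M}
    (h : sent P r m i j = some x) : (P i (state P r m i)).send j = some x := by
  unfold sent transmit at h
  split at h
  · exact h
  · split_ifs at h
    exact h

theorem le_of_sent_ne_none {P : Protocol n I M D} {r : Run n I} {m : ℕ} {i j : Fin n}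
    (h : sent P r m i j ≠ none) {c : Crash n} (hc : r.crash i = some c) :
    m < c.time ∨ (m = c.time ∧ j ∈ c.reached) := by
  by_contra h'
  exact h (by simp only [sent, hc, transmit, if_neg h'])

theorem sent_of_crash {P : Protocol n I M D} {r : Run n I} {i : Fin n} {c : Crash n}
    (hc : r.crash i = some c) (m : ℕ) (j : Fin n) :
    sent P r m i j = if m < c.time ∨ (m = c.time ∧ j ∈ c.reached)
      then (P i (state P r m i)).send j else none := by
  simp only [sent, hc, transmit]

theorem Nice.eq {r : Run n Bool} (h : Nice r) : r = ⟨fun _ => true, fun _ => none⟩ := by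
  obtain ⟨hi, hf⟩ := h
  cases r with
  | mk a c =>
    congr 1
    · exact funext hi
    · exact funext fun i => not_not.1 (hf i)

/-! ### Existence of biased-to-1 uniform consensus: flooding of the value 1 -/

/-- The process has initial value 1 or has received some message. -/
def SeenOne (s : LocalState n Bool M) : Prop :=
  s.input = true ∨ ∃ x ∈ s.received, ∃ j, x j ≠ none

open Classical in
/-- In every round a process that has learnt of an initial value 1 sends the message `x` to all;
at time `T` it decides 1 if it has learnt of an initial value 1, and 0 otherwise. -/
noncomputable def floodOnes (n T : ℕ) (x : M) : Protocol n Bool M Bool := fun _ s =>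
  ⟨fun _ => if SeenOne s then some x else none,
    if s.received.length = T then some (decide (SeenOne s)) else none, ∅⟩

theorem seenOne_state_succ (P : Protocol n Bool M D) (r : Run n Bool) (m : ℕ) (j : Fin n) :
    SeenOne (state P r (m + 1) j) ↔
      SeenOne (state P r m j) ∨ ∃ i, sent P r m i j ≠ none := by
  simp only [SeenOne, state_succ, input_state, List.mem_append, List.mem_singleton, or_and_right,
    exists_or, exists_eq_left, or_assoc]

theorem SeenOne.mono {P : Protocol n Bool M D} {r : Run n Bool} {m m' : ℕ} {j : Fin n}
    (h : SeenOne (state P r m j)) (hm : m ≤ m') : SeenOne (state P r m' j) := by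
  induction hm with
  | refl => exact h
  | step _ ih => exact (seenOne_state_succ ..).2 (.inl ih)

theorem seenOne_of_sent_floodOnes {T : ℕ} {x : M} {r : Run n Bool} {m : ℕ} {i j : Fin n}
    (h : sent (floodOnes n T x) r m i j ≠ none) : SeenOne (state (floodOnes n T x) r m i) := by
  by_contra h'
  exact send_ne_none_of_sent_ne_none h (by simp [floodOnes, h'])

theorem sent_floodOnes {T : ℕ} {x : M} {r : Run n Bool} {m : ℕ} {i : Fin n}
    (hi : CompletesRound r m i) (h : SeenOne (state (floodOnes n T x) r m i)) (j : Fin n) :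
    sent (floodOnes n T x) r m i j ≠ none := by
  simp [sent_of_completesRound _ hi, floodOnes, h]

theorem exists_input_of_seenOne_floodOnes {T : ℕ} {x : M} {r : Run n Bool} {m : ℕ} {i : Fin n}
    (h : SeenOne (state (floodOnes n T x) r m i)) : ∃ j, r.input j = true := by
  induction m generalizing i with
  | zero => exact ⟨i, by simpa [SeenOne, state] using h⟩
  | succ m ih =>
    rcases (seenOne_state_succ ..).1 h with h | ⟨k, hk⟩
    · exact ih h
    · exact ih (seenOne_of_sent_floodOnes hk)

theorem decides_floodOnes_iff {T : ℕ} {x : M} {r : Run n Bool} {i : Fin n} {m : ℕ} {b : Bool} :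
    Decides (floodOnes n T x) r i m b ↔
      (m = T ∧ (SeenOne (state (floodOnes n T x) r m i) ↔ b = true)) ∧
        ∀ c, r.crash i = some c → m < c.time ∨ (m = c.time ∧ c.decides = true) := by
  unfold Decides
  refine and_congr_left fun _ => ?_
  conv_lhs => simp only [floodOnes, length_received]
  split_ifs with h
  · cases b <;> simp [h]
  · simp [h]

/-- If after round `m + 1` nobody crashes before completing its sends, unless it is initially
dead, then all processes have seen a 1 at a later time if some process surviving that round has. -/
theorem seenOne_floodOnes_iff_of_clean {T : ℕ} {x : M} {r : Run n Bool} {m : ℕ}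
    (hm : ∀ i c, r.crash i = some c → c.time = m → InitiallyDead r i)
    {m' : ℕ} (hm' : m < m') {i : Fin n} (hi : CompletesRound r m i)
    (j : Fin n) :
    SeenOne (state (floodOnes n T x) r m' i) → SeenOne (state (floodOnes n T x) r m' j) := by
  intro h
  by_cases hp : ∃ p, CompletesRound r m p ∧ SeenOne (state (floodOnes n T x) r m p)
  · obtain ⟨p, hp, hs⟩ := hp
    exact SeenOne.mono ((seenOne_state_succ ..).2 (.inr ⟨p, sent_floodOnes hp hs j⟩)) hm'
  -- Ignorance of all survivors of the clean round persists: whoever sends at time `m` or later has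
  -- survived that round, because a process crashing in it is initially dead and reaches nobody.
  · exfalso
    push Not at hp
    have key : ∀ k, m ≤ k → ∀ p, CompletesRound r m p →
        ¬ SeenOne (state (floodOnes n T x) r k p) := by
      intro k hk
      induction k, hk using Nat.le_induction with
      | base => exact hp
      | succ k hk ih =>
        intro p hpc hs
        rcases (seenOne_state_succ ..).1 hs with hs | ⟨q, hq⟩
        · exact ih p hpc hs
        · refine ih q (fun c hc => ?_) (seenOne_of_sent_floodOnes hq)
          rcases le_of_sent_ne_none hq hc with h1 | ⟨h1, h2⟩
          · omega
          · rcases hk.lt_or_eq with h3 | h3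
            · omega
            · obtain ⟨d, hd, -, hd'⟩ := hm q c hc (by omega)
              rw [hc, Option.some.injEq] at hd
              subst hd
              simp [hd'] at h2
    exact key m' hm'.le i hi h

/-- Among `t + 1` rounds there is one in which only initially dead processes crash, if at most `t`
processes crash otherwise. -/
theorem exists_clean_round {r : Run n I} {t : ℕ}
    (ht : {i | Faulty r i ∧ ¬ InitiallyDead r i}.ncard ≤ t) :
    ∃ m < t + 1, ∀ i c, r.crash i = some c → c.time = m → InitiallyDead r i := by
  by_contra! h
  have : Nonempty (Fin n) := ⟨(h 0 t.succ_pos).choose⟩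
  have : Nonempty (Crash n) := ⟨(h 0 t.succ_pos).choose_spec.choose⟩
  choose! p c hc hcm hd using h
  -- A process crashes only once, so distinct rounds yield distinct processes.
  have hinj : Set.InjOn p (Finset.range (t + 1) : Set ℕ) := by
    intro a ha b hb hab
    simp only [Finset.coe_range, Set.mem_Iio] at ha hb
    have h1 := hc a ha
    rw [hab, hc b hb, Option.some.injEq] at h1
    rw [← hcm a ha, ← hcm b hb, h1]
  have hsub : p '' (Finset.range (t + 1) : Set ℕ) ⊆ {i | Faulty r i ∧ ¬ InitiallyDead r i} := by
    rintro _ ⟨a, ha, rfl⟩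
    simp only [Finset.coe_range, Set.mem_Iio] at ha
    exact ⟨by simp [Faulty, hc a ha], hd a ha⟩
  have h1 := Set.ncard_le_ncard hsub (Set.toFinite _)
  rw [hinj.ncard_image, Set.ncard_coe_finset, Finset.card_range] at h1
  omega

theorem isB1Consensus_floodOnes (n f t : ℕ) (x : M) : IsB1Consensus f t (floodOnes n (t + 1) x) where
  validity r _ i m b h := by
    obtain ⟨⟨-, h⟩, -⟩ := decides_floodOnes_iff.1 h
    cases b with
    | true => exact exists_input_of_seenOne_floodOnes (h.2 rfl)
    | false =>
      refine ⟨i, ?_⟩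
      by_contra hi
      exact Bool.false_ne_true (h.1 (.inl (by simpa [input_state] using hi)))
  decision r _ i hi := by
    classical
    exact ⟨t + 1, decide (SeenOne (state (floodOnes n (t + 1) x) r (t + 1) i)),
      decides_floodOnes_iff.2 ⟨⟨rfl, decide_eq_true_iff.symm⟩,
        fun c hc => .inl (completesRound_of_not_faulty hi _ c hc)⟩⟩
  agreement r _ ht i i' m m' b b' h h' := by
    obtain ⟨⟨rfl, h⟩, hc⟩ := decides_floodOnes_iff.1 h
    obtain ⟨⟨rfl, h'⟩, hc'⟩ := decides_floodOnes_iff.1 h'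
    obtain ⟨m, hm, hclean⟩ := exists_clean_round ht
    -- The clean round precedes the decision time `t + 1`, so every decider has survived it.
    have hi : CompletesRound r m i := fun c h => by have := hc c h; omega
    have hi' : CompletesRound r m i' := fun c h => by have := hc' c h; omega
    rw [Bool.eq_iff_iff, ← h, ← h']
    exact ⟨seenOne_floodOnes_iff_of_clean hclean hm hi i',
      seenOne_floodOnes_iff_of_clean hclean hm hi' i⟩
  biased r _ _ := by
    rintro ⟨j, hj, hj1⟩ i m b h
    obtain ⟨⟨rfl, h⟩, -⟩ := decides_floodOnes_iff.1 h
    refine h.1 (SeenOne.mono (m := 1) ((seenOne_state_succ ..).2 (.inr ⟨j, ?_⟩)) (by omega))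
    exact sent_floodOnes (completesRound_of_not_faulty hj 0) (.inl hj1) i

/-! ### Counting messages -/

/-- All pairs of distinct processes in round 1, and the pairs `(i, e i k)` in round 2. -/
def messageSlots {n f : ℕ} (e : Fin n → Fin f → Fin n) : Finset (ℕ × Fin n × Fin n) :=
  (Finset.univ : Finset (Fin n)).offDiag.image (fun p => (0, p)) ∪
    (Finset.univ : Finset (Fin n × Fin f)).image (fun p => (1, p.1, e p.1 p.2))

theorem mem_messageSlots {f : ℕ} {e : Fin n → Fin f → Fin n} {m : ℕ} {i j : Fin n} :
    (m, i, j) ∈ messageSlots e ↔ (m = 0 ∧ i ≠ j) ∨ (m = 1 ∧ ∃ k, e i k = j) := by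
  simp only [messageSlots, Finset.mem_union, Finset.mem_image, Finset.mem_offDiag,
    Finset.mem_univ, true_and, Prod.mk.injEq, Prod.exists]
  constructor
  · rintro (⟨a, b, h, rfl, rfl, rfl⟩ | ⟨a, b, rfl, rfl, rfl⟩)
    · exact .inl ⟨rfl, h⟩
    · exact .inr ⟨rfl, b, rfl⟩
  · rintro (⟨rfl, h⟩ | ⟨rfl, k, rfl⟩)
    · exact .inl ⟨i, j, h, rfl, rfl, rfl⟩
    · exact .inr ⟨i, k, rfl, rfl, rfl⟩

theorem card_messageSlots {f : ℕ} {e : Fin n → Fin f → Fin n}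
    (he : ∀ i, Function.Injective (e i)) : (messageSlots e).card = n ^ 2 + n * f - n := by
  rw [messageSlots, Finset.card_union_of_disjoint, Finset.card_image_of_injective,
    Finset.card_image_of_injective, Finset.offDiag_card]
  · simp only [Finset.card_univ, Fintype.card_fin, Fintype.card_prod]
    have : n ≤ n * n := Nat.le_mul_self n
    rw [pow_two]
    omega
  · rintro ⟨i, k⟩ ⟨i', k'⟩ h
    simp only [Prod.mk.injEq, true_and] at h
    obtain ⟨rfl, h⟩ := h
    rw [he i h]
  · intro p q h
    simpa using h
  · rw [Finset.disjoint_left]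
    intro x hx hy
    simp only [Finset.mem_image] at hx hy
    obtain ⟨p, -, rfl⟩ := hx
    obtain ⟨q, -, hq⟩ := hy
    simp at hq

/-! ### The lower bound -/

/-- The nice run. -/
def niceRun (n : ℕ) : Run n Bool := ⟨fun _ => true, fun _ => none⟩

theorem nice_niceRun (n : ℕ) : Nice (niceRun n) := ⟨fun _ => rfl, fun _ h => h rfl⟩

theorem inGammaTilde_niceRun (P : Protocol n Bool M D) (f : ℕ) :
    InGammaTilde P f (niceRun n) := by
  refine ⟨?_, fun i c hc => by simp [niceRun] at hc⟩
  simp [InGamma, Faulty, niceRun]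

/-- Crashing at time `t` before doing anything. -/
def Crash.before (t : ℕ) : Crash n := ⟨t, ∅, false⟩

/-- Process `j` has initial value 0 and is initially dead. -/
def deadZeroRun (j : Fin n) : Run n Bool :=
  ⟨fun i => decide (i ≠ j), fun i => if i = j then some (.before 0) else none⟩

theorem inGammaTilde_deadZeroRun (P : Protocol n Bool M D) {f : ℕ} (hf : 1 ≤ f) (j : Fin n) :
    InGammaTilde P f (deadZeroRun j) := by
  refine ⟨?_, fun i c hc _ => ?_⟩
  · have : {i | Faulty (deadZeroRun j) i} = {j} := by
      ext i
      simp [Faulty, deadZeroRun]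
    rw [InGamma, this, Set.ncard_singleton]
    exact hf
  · simp only [deadZeroRun, Option.ite_none_right_eq_some, Option.some.injEq] at hc
    obtain ⟨-, rfl⟩ := hc
    simp [Crash.before]

/-- A process that may act as in the nice run although some process has initial value 0 and
crashes before sending anything does not commit. -/
theorem not_commit_of_state_eq {P : Protocol n Bool M ACDecision} {f : ℕ} (hf : 1 ≤ f)
    (hP : SolvesAC f P) {i j : Fin n} (hij : i ≠ j) {m : ℕ}
    (hs : state P (deadZeroRun j) m i = state P (niceRun n) m i) :
    ¬ Decides P (niceRun n) i m commit := by
  intro h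
  have hd : Decides P (deadZeroRun j) i m commit := by
    refine ⟨by rw [hs]; exact h.1, fun c hc => ?_⟩
    simp [deadZeroRun, hij] at hc
  have := (hP _ (inGammaTilde_deadZeroRun P hf j)).commit_validity i m hd j
  simp [deadZeroRun] at this

/-- At time 0 a process knows only its own value, so a commit would ignore a possible 0 elsewhere;
an abort is excluded by abort validity. -/
theorem not_decides_zero_niceRun {P : Protocol n Bool M ACDecision} {f : ℕ} (hn : 2 ≤ n)
    (hf : 1 ≤ f) (hP : SolvesAC f P) (i : Fin n) (d : ACDecision) :
    ¬ Decides P (niceRun n) i 0 d := by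
  intro h
  cases d with
  | commit =>
    have : Nontrivial (Fin n) := Fin.nontrivial_iff_two_le.2 hn
    obtain ⟨j, hj⟩ := exists_ne i
    exact not_commit_of_state_eq hf hP hj.symm (by simp [state, deadZeroRun, niceRun, hj.symm]) h
  | abort =>
    rcases (hP _ (inGammaTilde_niceRun P f)).abort_validity i 0 h with ⟨j, hj⟩ | ⟨j, hj⟩
    · simp [niceRun] at hj
    · exact hj rfl

/-- This exempts the round 1 crash in `hiddenCommitRun` from the ordering condition of
`InGammaTilde`, so that it may reach any chosen set. -/
theorem decide_zero_eq_none {P : Protocol n Bool M ACDecision} {f : ℕ} (hn : 2 ≤ n)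
    (hf : 1 ≤ f) (hP : SolvesAC f P) (i : Fin n) : (P i ⟨true, []⟩).decide = none := by
  by_contra h
  obtain ⟨d, hd⟩ := Option.ne_none_iff_exists'.1 h
  exact not_decides_zero_niceRun hn hf hP i d ⟨hd, fun c hc => by simp [niceRun] at hc⟩

/-- Process `i` has to hear from every other process in round 1 of the nice run in order to
commit at time 1. -/
theorem sent_zero_niceRun {P : Protocol n Bool M ACDecision} {f : ℕ}
    (hf : 1 ≤ f) (hP : SolvesAC f P) {i j : Fin n} (hij : i ≠ j)
    (hi : Decides P (niceRun n) i 1 commit) : sent P (niceRun n) 0 j i ≠ none := by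
  intro h
  refine not_commit_of_state_eq hf hP hij ?_ hi
  simp only [state_succ]
  congr 1
  · simp [deadZeroRun, niceRun, hij]
  · simp only [state, List.nil_append, List.cons.injEq, and_true]
    funext k
    by_cases hk : k = j
    · subst hk
      rw [h]
      simp [sent, deadZeroRun, transmit, Crash.before]
    · simp [sent, deadZeroRun, niceRun, transmit, hk, state]

/-- The other processes to which `i` sends a message before deciding in round 2 of
the nice run. -/
noncomputable def earlyRecipients (P : Protocol n Bool M D) (i : Fin n) : Finset (Fin n) :=
  open Classical in
  Finset.univ.filter fun j => j ≠ i ∧ j ∈ (P i (state P (niceRun n) 1 i)).early ∧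
    (P i (state P (niceRun n) 1 i)).send j ≠ none

theorem mem_earlyRecipients {P : Protocol n Bool M D} {i j : Fin n} :
    j ∈ earlyRecipients P i ↔ j ≠ i ∧ j ∈ (P i (state P (niceRun n) 1 i)).early ∧
      (P i (state P (niceRun n) 1 i)).send j ≠ none := by
  simp [earlyRecipients]

/-- All initial values are 1, but only `i` hears of `j`; then `i` crashes right after its decision
in round 2, and its early recipients crash before round 3. -/
noncomputable def hiddenCommitRun (P : Protocol n Bool M D) (i j : Fin n) : Run n Bool :=
  ⟨fun _ => true, fun p => if p = j then some ⟨0, {i}, false⟩ else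
    if p = i then some ⟨1, (P i (state P (niceRun n) 1 i)).early, true⟩ else
    if p ∈ earlyRecipients P i then some (.before 2) else none⟩

/-- Process `j` has initial value 0 and is initially dead; then `i` crashes before round 2,
and the processes that are early recipients of `i` in the nice run crash before round 3. -/
noncomputable def hiddenZeroRun (P : Protocol n Bool M D) (i j : Fin n) : Run n Bool :=
  ⟨fun p => decide (p ≠ j), fun p => if p = j then some (.before 0) else
    if p = i then some (.before 1) else
    if p ∈ earlyRecipients P i then some (.before 2) else none⟩

/-- The message of `j` to `i` gets through, and all other crashes come after round 1. -/
theorem state_hiddenCommitRun_self (P : Protocol n Bool M D) {i j : Fin n} (hij : i ≠ j) :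
    state P (hiddenCommitRun P i j) 1 i = state P (niceRun n) 1 i := by
  simp only [state_succ]
  congr 1
  simp only [state, List.nil_append, List.cons.injEq, and_true]
  funext k
  rw [sent_of_not_faulty P ((nice_niceRun n).2 k)]
  simp only [sent, hiddenCommitRun, transmit, state, niceRun]
  by_cases hk : k = j
  · simp [hk]
  by_cases hk' : k = i
  · simp [hk', hij]
  by_cases hk'' : k ∈ earlyRecipients P i <;> simp [hk, hk', hk'', Crash.before]

/-- The value of `j` can influence only `i`, whose differing round 2 messages reach only early
recipients, and these crash before passing anything on. The early recipients still send in rounds 1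
and 2, so the induction needs their states up to time 1. -/
theorem state_hidden_eq (P : Protocol n Bool M D) {i j : Fin n} (hij : i ≠ j) (m : ℕ) :
    ∀ p, p ≠ i → p ≠ j → (m ≤ 1 ∨ p ∉ earlyRecipients P i) →
      state P (hiddenCommitRun P i j) m p = state P (hiddenZeroRun P i j) m p := by
  induction m with
  | zero =>
    intro p _ hpj _
    simp [state, hiddenCommitRun, hiddenZeroRun, hpj]
  | succ m ih =>
    intro p hpi hpj hp
    have hp' : m ≤ 1 ∨ p ∉ earlyRecipients P i := hp.imp_left (by omega)
    rw [state_succ, state_succ, ih p hpi hpj hp']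
    congr 1
    · simp [hiddenCommitRun, hiddenZeroRun, hpj]
    congr 2
    funext q
    by_cases hqj : q = j
    · subst hqj
      simp [sent, hiddenCommitRun, hiddenZeroRun, transmit, Crash.before, hpi]
    by_cases hqi : q = i
    · subst hqi
      have h1 : (hiddenCommitRun P q j).crash q =
          some ⟨1, (P q (state P (niceRun n) 1 q)).early, true⟩ := by
        simp [hiddenCommitRun, hqj]
      have h2 : (hiddenZeroRun P q j).crash q = some (.before 1) := by
        simp [hiddenZeroRun, hqj]
      rw [sent_of_crash h1, sent_of_crash h2]
      rcases Nat.lt_trichotomy m 1 with hm | rfl | hm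
      · obtain rfl : m = 0 := by omega
        simp [state, hiddenCommitRun, hiddenZeroRun, hqj, Crash.before]
      · have hpe : p ∉ earlyRecipients P q := hp.resolve_left (by omega)
        rw [mem_earlyRecipients] at hpe
        rw [state_hiddenCommitRun_self P hij]
        simp only [Crash.before, lt_irrefl, true_and, false_or, Finset.notMem_empty, if_false,
          ite_eq_right_iff]
        intro h
        by_contra h'
        exact hpe ⟨hpi, h, h'⟩
      · simp [Crash.before, hm.not_gt, hm.ne']
    by_cases hqe : q ∈ earlyRecipients P i
    · have h1 : (hiddenCommitRun P i j).crash q = some (.before 2) := by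
        simp [hiddenCommitRun, hqj, hqi, hqe]
      have h2 : (hiddenZeroRun P i j).crash q = some (.before 2) := by
        simp [hiddenZeroRun, hqj, hqi, hqe]
      rw [sent_of_crash h1, sent_of_crash h2]
      by_cases hm : m ≤ 1
      · rw [ih q hqi hqj (.inl hm)]
      · simp [Crash.before, show ¬ m < 2 by omega]
    · simp only [sent]
      rw [ih q hqi hqj (.inr hqe)]
      simp [hiddenCommitRun, hiddenZeroRun, hqj, hqi]

theorem inGamma_of_faulty_subset {r : Run n I} {f : ℕ} {s : Finset (Fin n)}
    (hs : ∀ i, Faulty r i → i ∈ s) (hf : s.card ≤ f) : InGamma f r := by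
  refine le_trans ?_ hf
  rw [← Set.ncard_coe_finset]
  exact Set.ncard_le_ncard hs (Finset.finite_toSet s)

/-- Before committing in round 2 of the nice run, a process must have sent messages to at least
`f` others. -/
theorem le_card_earlyRecipients {P : Protocol n Bool M ACDecision} {f : ℕ} (hn : 2 ≤ n)
    (hf : 1 < f) (hfn : f < n) (hP : SolvesAC f P) {i : Fin n}
    (hi : Decides P (niceRun n) i 1 commit) : f ≤ (earlyRecipients P i).card := by
  classical
  by_contra! hcard
  set E := earlyRecipients P i with hE
  have hiE : i ∉ E := by simp [hE, mem_earlyRecipients]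
  -- Taking `j` among the early recipients costs no extra crash. If there are none, only `i` and `j`
  -- crash, which is where `1 < f` enters.
  obtain ⟨j, hji, hs⟩ : ∃ j, j ≠ i ∧ (insert i (insert j E)).card ≤ f := by
    rcases E.eq_empty_or_nonempty with h | ⟨j, hj⟩
    · have : Nontrivial (Fin n) := Fin.nontrivial_iff_two_le.2 hn
      obtain ⟨j, hj⟩ := exists_ne i
      refine ⟨j, hj, ?_⟩
      rw [h]
      exact Finset.card_le_two.trans hf
    · refine ⟨j, fun h => hiE (h ▸ hj), ?_⟩
      rw [Finset.insert_eq_of_mem hj]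
      exact (Finset.card_insert_le _ _).trans hcard
  have hij := hji.symm
  have hfaulty : ∀ p, p ∉ insert i (insert j E) →
      p ≠ i ∧ p ≠ j ∧ p ∉ E := fun p hp => by simpa using hp
  have hC : InGammaTilde P f (hiddenCommitRun P i j) := by
    refine ⟨inGamma_of_faulty_subset (fun p hp => ?_) hs, fun p c hc hdec => ?_⟩
    · by_contra hp'
      obtain ⟨h1, h2, h3⟩ := hfaulty p hp'
      exact hp (by simp [hiddenCommitRun, h1, h2, ← hE, h3])
    · simp only [hiddenCommitRun] at hc
      split_ifs at hc with h1 h2 h3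
      · obtain rfl := Option.some.inj hc
        exact absurd (decide_zero_eq_none hn hf.le hP p) hdec
      · obtain rfl := Option.some.inj hc
        subst h2
        simp [state_hiddenCommitRun_self P hij]
        tauto
      · obtain rfl := Option.some.inj hc
        simp [Crash.before]
  have hZ : InGammaTilde P f (hiddenZeroRun P i j) := by
    refine ⟨inGamma_of_faulty_subset (fun p hp => ?_) hs, fun p c hc _ => ?_⟩
    · by_contra hp'
      obtain ⟨h1, h2, h3⟩ := hfaulty p hp'
      exact hp (by simp [hiddenZeroRun, h1, h2, ← hE, h3])
    · simp only [hiddenZeroRun] at hc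
      split_ifs at hc <;> obtain rfl := Option.some.inj hc <;> simp [Crash.before]
  -- At most `f < n` processes crash, so there is a survivor `q`, which must commit in the first run
  -- by agreement and hence also in the second.
  obtain ⟨q, hq⟩ : ∃ q, q ∉ insert i (insert j E) := by
    by_contra! h
    have := Finset.card_le_card (fun x _ => h x : Finset.univ ⊆ insert i (insert j E))
    simp at this
    omega
  obtain ⟨hqi, hqj, hqE⟩ := hfaulty q hq
  have hcommit : Decides P (hiddenCommitRun P i j) i 1 commit := by
    refine ⟨by rw [state_hiddenCommitRun_self P hij]; exact hi.1, fun c hc => ?_⟩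
    simp only [hiddenCommitRun, if_neg hij, if_true, Option.some.injEq] at hc
    subst hc
    exact .inr ⟨rfl, rfl⟩
  obtain ⟨m, d, hd⟩ := (hP _ hC).decision q (by simp [Faulty, hiddenCommitRun, hqi, hqj, ← hE, hqE])
  obtain rfl := (hP _ hC).agreement _ _ _ _ _ _ hcommit hd
  have hd' : Decides P (hiddenZeroRun P i j) q m commit := by
    refine ⟨by rw [← state_hidden_eq P hij m q hqi hqj (.inr hqE)]; exact hd.1, fun c hc => ?_⟩
    simp [hiddenZeroRun, hqi, hqj, ← hE, hqE] at hc
  have := (hP _ hZ).commit_validity q m hd' j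
  simp [hiddenZeroRun] at this

theorem le_messageCount_of_solvesAC {P : Protocol n Bool M ACDecision} {f : ℕ} (hn : 2 ≤ n)
    (hf : 1 < f) (hfn : f < n) (hP : SolvesAC f P)
    (hc : ∀ i, ∃ m < 2, Decides P (niceRun n) i m commit) :
    ((n ^ 2 + n * f - n : ℕ) : ℕ∞) ≤ messageCount P (niceRun n) := by
  have hc1 : ∀ i, Decides P (niceRun n) i 1 commit := by
    intro i
    obtain ⟨m, hm, h⟩ := hc i
    interval_cases m
    · exact absurd h (not_decides_zero_niceRun hn hf.le hP i _)
    · exact h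
  have he : ∀ i, ∃ e : Fin f → Fin n, Function.Injective e ∧ ∀ k, e k ∈ earlyRecipients P i := by
    intro i
    have hle := le_card_earlyRecipients hn hf hfn hP (hc1 i)
    refine ⟨fun k => (earlyRecipients P i).equivFin.symm (Fin.castLE hle k), ?_, fun k => ?_⟩
    · exact Subtype.val_injective.comp
        ((Equiv.injective _).comp (Fin.castLE_injective hle))
    · exact Subtype.property _
  choose e hinj hmem using he
  rw [← card_messageSlots hinj, ← Set.encard_coe_eq_coe_finsetCard]
  refine Set.encard_le_encard ?_
  rintro ⟨m, i, j⟩ h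
  rw [Finset.mem_coe, mem_messageSlots] at h
  rcases h with ⟨rfl, h⟩ | ⟨rfl, k, rfl⟩
  · exact ⟨h, sent_zero_niceRun hf.le hP h.symm (hc1 j)⟩
  · have h := mem_earlyRecipients.1 (hmem i k)
    exact ⟨h.1.symm, by rw [sent_of_not_faulty P ((nice_niceRun n).2 i)]; exact h.2.2⟩

/-! ### Correctness of the 1.5D protocol -/

theorem received_state (P : Protocol n I M D) (r : Run n I) (m : ℕ) (i : Fin n) :
    (state P r m i).received = (List.range m).map fun k j => sent P r k j i := by
  induction m with
  | zero => rfl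
  | succ m ih => rw [state_succ, ih, List.range_succ, List.map_append]; rfl

theorem state_eq (P : Protocol n I M D) (r : Run n I) (m : ℕ) (i : Fin n) :
    state P r m i = ⟨r.input i, (List.range m).map fun k j => sent P r k j i⟩ := by
  rw [← received_state, ← input_state P r m i]

theorem state_add_two (P : Protocol n I M D) (r : Run n I) (m : ℕ) (i : Fin n) :
    state P r (m + 2) i = ⟨r.input i, (fun j => sent P r 0 j i) :: (fun j => sent P r 1 j i) ::
      (List.range m).map fun k j => sent P r (k + 2) j i⟩ := by
  rw [state_eq, List.range_succ_eq_map, List.range_succ_eq_map]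
  simp [Function.comp_def]

theorem Decides.completesRound {P : Protocol n I M D} {r : Run n I} {i : Fin n} {m : ℕ} {d : D}
    (h : Decides P r i m d) {k : ℕ} (hk : k < m) : CompletesRound r k i := fun c hc => by
  have := h.2 c hc
  omega

section

variable {f : ℕ} {μ : Type*} (C : Protocol n Bool μ Bool) (r : Run n Bool)

/-- Process `i` receives '1' from all in round 1. -/
def HearsOnes (f : ℕ) (i : Fin n) : Prop :=
  ∀ j, (sent (protocol15D n f C) r 0 j i).any Msg.isOne = true

/-- Process `i` receives 'huh?' from somebody in round 2. -/
def HearsHuh (f : ℕ) (i : Fin n) : Prop :=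
  ∃ j, (sent (protocol15D n f C) r 1 j i).any Msg.isHuh = true

/-- Process `i` receives `all[1]` from somebody in round 2. -/
def HearsAllOnes (f : ℕ) (i : Fin n) : Prop :=
  ∃ j, (sent (protocol15D n f C) r 1 j i).any Msg.isAllOnes = true

/-- The recipients of the `all[1]` messages of process `i`. -/
def IsSuccessor (f : ℕ) (i j : Fin n) : Prop :=
  ∃ k : Fin f, (j : ℕ) = ((i : ℕ) + ((k : ℕ) + 1)) % n

instance (i : Fin n) : Decidable (HearsOnes C r f i) := inferInstanceAs (Decidable (∀ _, _))

instance (i : Fin n) : Decidable (HearsHuh C r f i) := inferInstanceAs (Decidable (∃ _, _))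

instance (i : Fin n) : Decidable (HearsAllOnes C r f i) := inferInstanceAs (Decidable (∃ _, _))

instance (i j : Fin n) : Decidable (IsSuccessor f i j) := inferInstanceAs (Decidable (∃ _, _))

/-- The run of the consensus subroutine that takes place from time 2 on. -/
def consensusRun (f : ℕ) : Run n Bool where
  input i := decide (HearsOnes C r f i ∨ HearsAllOnes C r f i)
  -- Whoever crashes in the first two rounds takes no part in the subroutine and becomes initially
  -- dead there, hence does not count against the tolerance.
  crash i := (r.crash i).map fun c =>
    if c.time < 2 then ⟨0, ∅, false⟩ else ⟨c.time - 2, c.reached, c.decides⟩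

/-- The local state of the subroutine at process `i` at its time `m`. -/
def subroutineState (f m : ℕ) (i : Fin n) : LocalState n Bool μ :=
  ⟨(consensusRun C r f).input i,
    (List.range m).map fun k j => (sent (protocol15D n f C) r (k + 2) j i).bind Msg.toCons⟩

theorem protocol15D_state_zero (i : Fin n) :
    protocol15D n f C i (state (protocol15D n f C) r 0 i) =
      if r.input i = true then ⟨fun _ => some Msg.one, none, ∅⟩ else Action.silent := rfl

theorem protocol15D_state_one (i : Fin n) :
    protocol15D n f C i (state (protocol15D n f C) r 1 i) =
      if HearsOnes C r f i then
        ⟨fun j => if IsSuccessor f i j then some Msg.allOnes else none,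
          some commit, Finset.univ⟩
      else ⟨fun _ => some Msg.huh, none, ∅⟩ := rfl

theorem protocol15D_state_add_two (m : ℕ) (i : Fin n) :
    protocol15D n f C i (state (protocol15D n f C) r (m + 2) i) =
      if HearsHuh C r f i then
        ⟨fun j => ((C i (subroutineState C r f m i)).send j).map Msg.cons,
          if HearsOnes C r f i then none
            else (C i (subroutineState C r f m i)).decide.map
              fun b => if b = true then commit else abort, ∅⟩
      else Action.silent := by
  rw [state_add_two]
  by_cases h : HearsHuh C r f i
  · have h' : ¬ ∀ j, (sent (protocol15D n f C) r 1 j i).any Msg.isHuh = false := by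
      simpa [HearsHuh] using h
    rw [if_pos h]
    simp only [protocol15D, if_neg h', List.map_map, Function.comp_def, subroutineState,
      consensusRun, Bool.decide_or, decide_eq_true_eq]
    rfl
  · have h' : ∀ j, (sent (protocol15D n f C) r 1 j i).any Msg.isHuh = false := by
      simpa [HearsHuh] using h
    rw [if_neg h]
    simp only [protocol15D, if_pos h']

variable {C r}

/-! ### What the messages of rounds 1 and 2 reveal. -/

theorem input_of_isOne {i j : Fin n}
    (h : (sent (protocol15D n f C) r 0 j i).any Msg.isOne = true) : r.input j = true := by
  obtain ⟨x, hx, -⟩ := (Option.any_eq_true _ _).1 h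
  have := send_eq_of_sent_eq hx
  rw [protocol15D_state_zero] at this
  split_ifs at this with h'
  · exact h'
  · simp [Action.silent] at this

theorem isOne_of_completesRound {i j : Fin n} (h : r.input j = true)
    (hj : CompletesRound r 0 j) :
    (sent (protocol15D n f C) r 0 j i).any Msg.isOne = true := by
  rw [sent_of_completesRound _ hj, protocol15D_state_zero, if_pos h]
  rfl

theorem HearsOnes.input {i : Fin n} (h : HearsOnes C r f i) (j : Fin n) : r.input j = true :=
  input_of_isOne (h j)

theorem exists_hearsOnes_of_hearsAllOnes {i : Fin n} (h : HearsAllOnes C r f i) :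
    ∃ j, HearsOnes C r f j := by
  obtain ⟨j, h⟩ := h
  obtain ⟨x, hx, hx1⟩ := (Option.any_eq_true _ _).1 h
  have := send_eq_of_sent_eq hx
  rw [protocol15D_state_one] at this
  split_ifs at this with h'
  · exact ⟨j, h'⟩
  · obtain rfl := Option.some.inj this
    simp [Msg.isAllOnes] at hx1

theorem hearsHuh_of_not_hearsOnes {i : Fin n} (h : ¬ HearsOnes C r f i)
    (hi : CompletesRound r 1 i) (j : Fin n) : HearsHuh C r f j := by
  refine ⟨i, ?_⟩
  rw [sent_of_completesRound _ hi, protocol15D_state_one, if_neg h]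
  rfl

/-- A missing '1' from a process with value 1 betrays a crash in round 1; this crash is the one that
`C` need not tolerate. -/
theorem exists_crash_of_not_hearsOnes {i : Fin n} (h : ¬ HearsOnes C r f i)
    (hr : ∀ j, r.input j = true) : ∃ j c, r.crash j = some c ∧ c.time = 0 := by
  by_contra! h'
  exact h fun j => isOne_of_completesRound (hr j) fun c hc => Nat.pos_of_ne_zero (h' j c hc)

/-! ### The subroutine as a run of `C` on its own, shifted by two rounds. -/

theorem consensusRun_crash_eq_some {i : Fin n} {c : Crash n} (hc : r.crash i = some c) :
    (consensusRun C r f).crash i =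
      some (if c.time < 2 then ⟨0, ∅, false⟩ else ⟨c.time - 2, c.reached, c.decides⟩) := by
  simp [consensusRun, hc]

theorem faulty_consensusRun {i : Fin n} : Faulty (consensusRun C r f) i ↔ Faulty r i := by
  simp [Faulty, consensusRun]

theorem transmit_consensusRun (i : Fin n) (m : ℕ) (a : Action n μ Bool) (j : Fin n) :
    transmit ((consensusRun C r f).crash i) m a j = transmit (r.crash i) (m + 2) a j := by
  cases hc : r.crash i with
  | none => simp [consensusRun, hc, transmit]
  | some c =>
    rw [consensusRun_crash_eq_some hc]
    simp only [transmit]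
    refine if_congr ?_ rfl rfl
    split_ifs with h
    · simp
      omega
    · refine or_congr (by simp; omega) (and_congr_left fun _ => by simp; omega)

theorem map_cons_bind_toCons (x : Option μ) : (x.map Msg.cons).bind Msg.toCons = x := by
  cases x <;> rfl

/-- If everybody runs the subroutine, then it behaves as in `consensusRun`. -/
theorem state_consensusRun (hh : ∀ i, HearsHuh C r f i) (m : ℕ) (i : Fin n) :
    state C (consensusRun C r f) m i = subroutineState C r f m i := by
  induction m using Nat.strong_induction_on generalizing i with
  | _ m ih =>
    rw [state_eq, subroutineState]
    congr 1
    refine List.map_congr_left fun k hk => funext fun j => ?_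
    rw [sent, sent, transmit_consensusRun, ih k (List.mem_range.1 hk),
      protocol15D_state_add_two, if_pos (hh j)]
    unfold transmit
    split
    · exact (map_cons_bind_toCons _).symm
    · by_cases h : k + 2 < Crash.time ‹_› ∨ k + 2 = Crash.time ‹_› ∧ i ∈ Crash.reached ‹_›
      · simp only [if_pos h]
        exact (map_cons_bind_toCons _).symm
      · simp only [if_neg h]
        rfl

theorem decides_add_two_iff (hh : ∀ i, HearsHuh C r f i) {i : Fin n}
    (hi : ¬ HearsOnes C r f i) {m : ℕ} {d : ACDecision} :
    Decides (protocol15D n f C) r i (m + 2) d ↔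
      ∃ b, Decides C (consensusRun C r f) i m b ∧ (if b = true then commit else abort) = d := by
  have hcrash : (∀ c, r.crash i = some c → m + 2 < c.time ∨ (m + 2 = c.time ∧ c.decides = true)) ↔
      ∀ c, (consensusRun C r f).crash i = some c →
        m < c.time ∨ (m = c.time ∧ c.decides = true) := by
    cases hc : r.crash i with
    | none => simp [consensusRun, hc]
    | some c =>
      rw [consensusRun_crash_eq_some hc]
      simp only [Option.some.injEq, forall_eq']
      split_ifs with h
      · simp
        omega
      · exact or_congr (by simp; omega) (and_congr_left fun _ => by simp; omega)
  unfold Decides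
  rw [hcrash, protocol15D_state_add_two, if_pos (hh i), state_consensusRun hh]
  simp only [if_neg hi, Option.map_eq_some_iff]
  constructor
  · rintro ⟨⟨b, hb, hd⟩, h⟩
    exact ⟨b, ⟨hb, h⟩, hd⟩
  · rintro ⟨b, ⟨hb, h⟩, hd⟩
    exact ⟨⟨b, hb, hd⟩, h⟩

/-- Decisions are either commits in the middle of round 2, or decisions of the subroutine, which
is then run by everybody. -/
theorem decides_protocol15D {i : Fin n} {m : ℕ} {d : ACDecision}
    (h : Decides (protocol15D n f C) r i m d) :
    (m = 1 ∧ d = commit ∧ HearsOnes C r f i) ∨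
      (¬ HearsOnes C r f i ∧ (∀ j, HearsHuh C r f j) ∧
        ∃ k b, Decides C (consensusRun C r f) i k b ∧
          (if b = true then commit else abort) = d) := by
  match m with
  | 0 =>
    have h1 := h.1
    rw [protocol15D_state_zero] at h1
    split_ifs at h1
    simp [Action.silent] at h1
  | 1 =>
    have h1 := h.1
    rw [protocol15D_state_one] at h1
    split_ifs at h1 with h2
    exact .inl ⟨rfl, (Option.some.inj h1).symm, h2⟩
  | m + 2 =>
    have hi : ¬ HearsOnes C r f i := by
      intro hi
      have h1 := h.1
      rw [protocol15D_state_add_two, if_pos hi] at h1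
      split_ifs at h1
      simp [Action.silent] at h1
    -- A decision after time 1 shows that `i` completed round 2, so its 'huh?' reached everybody.
    have hh := hearsHuh_of_not_hearsOnes hi (h.completesRound (by omega))
    exact .inr ⟨hi, hh, m, (decides_add_two_iff hh hi).1 h⟩

/-! ### Crash counting and agreement. -/

theorem inGamma_consensusRun (hr : InGamma f r) : InGamma f (consensusRun C r f) := by
  simpa only [InGamma, faulty_consensusRun] using hr

/-- A crash in round 1 leaves at most `f - 1` crashes that the subroutine can notice. -/
theorem ncard_not_initiallyDead_consensusRun_le (hr : InGamma f r) {j : Fin n} {c : Crash n}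
    (hc : r.crash j = some c) (h0 : c.time = 0) :
    {i | Faulty (consensusRun C r f) i ∧ ¬ InitiallyDead (consensusRun C r f) i}.ncard
      ≤ f - 1 := by
  have hj : j ∈ {i | Faulty r i} := by simp [Faulty, hc]
  have hsub : {i | Faulty (consensusRun C r f) i ∧ ¬ InitiallyDead (consensusRun C r f) i} ⊆
      {i | Faulty r i} \ {j} := by
    rintro i ⟨h1, h2⟩
    refine ⟨faulty_consensusRun.1 h1, ?_⟩
    rintro rfl
    refine h2 ⟨⟨0, ∅, false⟩, ?_, rfl, rfl⟩
    rw [consensusRun_crash_eq_some hc, if_pos (by omega)]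
  refine (Set.ncard_le_ncard hsub (Set.toFinite _)).trans ?_
  rw [Set.ncard_sdiff_singleton_of_mem hj]
  exact Nat.sub_le_sub_right hr 1

/-- The shifts `1, …, f` are distinct modulo `n` since `f < n`. -/
theorem injective_successor (hfn : f < n) (i : Fin n) :
    Function.Injective fun k : Fin f =>
      (⟨((i : ℕ) + ((k : ℕ) + 1)) % n, Nat.mod_lt _ (by omega)⟩ : Fin n) := by
  intro k k' h
  have h : (i : ℕ) + ((k : ℕ) + 1) ≡ (i : ℕ) + ((k' : ℕ) + 1) [MOD n] := Fin.mk.inj_iff.1 h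
  have := Nat.ModEq.eq_of_lt_of_lt (Nat.ModEq.add_left_cancel' _ h) (by omega) (by omega)
  exact Fin.ext (by omega)

theorem IsSuccessor.ne (hfn : f < n) {i j : Fin n} (h : IsSuccessor f i j) : i ≠ j := by
  rintro rfl
  obtain ⟨k, hk⟩ := h
  have h : (i : ℕ) + ((k : ℕ) + 1) ≡ (i : ℕ) + 0 [MOD n] := by
    rw [Nat.ModEq, add_zero, ← hk, Nat.mod_eq_of_lt i.2]
  have := Nat.ModEq.eq_of_lt_of_lt (Nat.ModEq.add_left_cancel' _ h) (by omega) (by omega)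
  omega

/-- A process that commits in round 2 has informed `f` others, so that some correct process runs
the subroutine with initial value 1. -/
theorem exists_correct_input_one (hfn : f < n) (hr : InGammaTilde (protocol15D n f C) f r)
    {i : Fin n} (hi : HearsOnes C r f i)
    (hd : Decides (protocol15D n f C) r i 1 commit) :
    ∃ j, ¬ Faulty (consensusRun C r f) j ∧ (consensusRun C r f).input j = true := by
  by_contra! hall
  have hsucc : ∀ j, IsSuccessor f i j → HearsAllOnes C r f j := by
    intro j hj
    refine ⟨i, ?_⟩
    have hsend : (protocol15D n f C i (state (protocol15D n f C) r 1 i)).send j =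
        some Msg.allOnes := by
      rw [protocol15D_state_one, if_pos hi]
      exact if_pos hj
    have hsent : sent (protocol15D n f C) r 1 i j = some Msg.allOnes := by
      cases hc : r.crash i with
      | none => rw [sent_of_not_faulty _ (by simp [Faulty, hc]), hsend]
      | some c =>
        rw [sent_of_crash hc, hsend, if_pos]
        rcases hd.2 c hc with h | ⟨h1, h2⟩
        · exact .inl h
        · refine .inr ⟨h1, ?_⟩
          -- Even if `i` crashes in round 2, it did commit, so in this context all messages placed
          -- before the commit were sent.
          have := hr.2 i c hc
          rw [← h1] at this
          refine (this ?_).1 h2 j ?_ ?_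
          · rw [hd.1]
            exact Option.some_ne_none _
          · rw [protocol15D_state_one, if_pos hi]
            exact Finset.mem_univ _
          · rw [hsend]
            exact Option.some_ne_none _
    rw [hsent]
    rfl
  set e : Fin f → Fin n := fun k => ⟨((i : ℕ) + ((k : ℕ) + 1)) % n, Nat.mod_lt _ (by omega)⟩
  have he : ∀ k, IsSuccessor f i (e k) := fun k => ⟨k, rfl⟩
  have hfaulty : ∀ j, HearsOnes C r f j ∨ HearsAllOnes C r f j → Faulty r j := by
    intro j hj
    by_contra hj'
    exact hall j (mt faulty_consensusRun.1 hj') (by simpa [consensusRun] using hj)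
  -- Otherwise `i` and its `f` successors would be `f + 1` faulty processes.
  have hsub : ((insert i (Finset.univ.image e) : Finset (Fin n)) : Set (Fin n)) ⊆
      {j | Faulty r j} := by
    intro j hj
    simp only [Finset.coe_insert, Finset.coe_image, Finset.coe_univ, Set.image_univ,
      Set.mem_insert_iff, Set.mem_range] at hj
    rcases hj with rfl | ⟨k, rfl⟩
    · exact hfaulty _ (.inl hi)
    · exact hfaulty _ (.inr (hsucc _ (he k)))
  have hcard := (Set.ncard_le_ncard hsub (Set.toFinite _)).trans hr.1
  rw [Set.ncard_coe_finset, Finset.card_insert_of_notMem,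
    Finset.card_image_of_injective _ (injective_successor hfn i), Finset.card_univ,
    Fintype.card_fin] at hcard
  · omega
  · simp only [Finset.mem_image, Finset.mem_univ, true_and, not_exists]
    exact fun k hk => (he k).ne hfn hk.symm

theorem agreement_protocol15D (hfn : f < n) (hC : IsB1Consensus f (f - 1) C)
    (hr : InGammaTilde (protocol15D n f C) f r) {i i' : Fin n} {m m' : ℕ} {d d' : ACDecision}
    (h : Decides (protocol15D n f C) r i m d) (h' : Decides (protocol15D n f C) r i' m' d') :
    d = d' := by
  -- a commit in round 2 and a decision of the subroutine
  have mixed : ∀ {p q k b}, Decides (protocol15D n f C) r p 1 commit → HearsOnes C r f p →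
      ¬ HearsOnes C r f q → Decides C (consensusRun C r f) q k b → b = true := by
    intro p q k b hp hp1 hq hb
    obtain ⟨j, c, hc, h0⟩ := exists_crash_of_not_hearsOnes hq hp1.input
    exact hC.biased _ (inGamma_consensusRun hr.1)
      (ncard_not_initiallyDead_consensusRun_le hr.1 hc h0)
      (exists_correct_input_one hfn hr hp1 hp) _ _ _ hb
  rcases decides_protocol15D h with ⟨rfl, rfl, h1⟩ | ⟨h1, hh, k, b, hb, rfl⟩ <;>
    rcases decides_protocol15D h' with ⟨rfl, rfl, h1'⟩ | ⟨h1', hh', k', b', hb', rfl⟩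
  · rfl
  · rw [if_pos (mixed h h1 h1' hb')]
  · rw [if_pos (mixed h' h1' h1 hb)]
  · suffices b = b' by rw [this]
    -- If all values are 1, a round 1 crash brings the subroutine within its tolerance. Otherwise
    -- agreement of `C` may fail to apply, but all its inputs are 0.
    by_cases hin : ∀ j, r.input j = true
    · obtain ⟨j, c, hc, h0⟩ := exists_crash_of_not_hearsOnes h1 hin
      exact hC.agreement _ (inGamma_consensusRun hr.1)
        (ncard_not_initiallyDead_consensusRun_le hr.1 hc h0) _ _ _ _ _ _ hb hb'
    · have hno : ∀ j, ¬ HearsOnes C r f j := fun j hj => hin hj.input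
      have hzero : ∀ j, (consensusRun C r f).input j = false := by
        intro j
        have : ¬ HearsAllOnes C r f j := fun hj =>
          (exists_hearsOnes_of_hearsAllOnes hj).elim hno
        simp [consensusRun, hno j, this]
      obtain ⟨j, rfl⟩ := hC.validity _ (inGamma_consensusRun hr.1) _ _ _ hb
      obtain ⟨j', rfl⟩ := hC.validity _ (inGamma_consensusRun hr.1) _ _ _ hb'
      rw [hzero, hzero]

theorem solvesAC_protocol15D (hfn : f < n) (hC : IsB1Consensus f (f - 1) C) :
    SolvesAC f (protocol15D n f C) := fun r hr => by
  refine ⟨fun i hi => ?_, fun i i' m m' d d' h h' => agreement_protocol15D hfn hC hr h h',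
    fun i m h => ?_, fun i m h => ?_⟩
  · by_cases h1 : HearsOnes C r f i
    · refine ⟨1, commit, ?_, fun c hc => .inl (completesRound_of_not_faulty hi 1 c hc)⟩
      rw [protocol15D_state_one, if_pos h1]
    · have hh := hearsHuh_of_not_hearsOnes h1 (completesRound_of_not_faulty hi 1)
      obtain ⟨m, b, hb⟩ := hC.decision _ (inGamma_consensusRun hr.1) i
        (mt faulty_consensusRun.1 hi)
      exact ⟨m + 2, _, (decides_add_two_iff hh h1).2 ⟨b, hb, rfl⟩⟩
  · rcases decides_protocol15D h with ⟨-, -, h1⟩ | ⟨-, -, k, b, hb, hd⟩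
    · exact h1.input
    · obtain rfl : b = true := by
        by_contra hb
        simp [hb] at hd
      -- This `j` may have crashed before time 2, but its formal input 1 still shows that some
      -- process heard '1' from all.
      obtain ⟨j, hj⟩ := hC.validity _ (inGamma_consensusRun hr.1) _ _ _ hb
      obtain hj | hj : HearsOnes C r f j ∨ HearsAllOnes C r f j := by
        simpa [consensusRun] using hj
      · exact hj.input
      · obtain ⟨p, hp⟩ := exists_hearsOnes_of_hearsAllOnes hj
        exact hp.input
  · rcases decides_protocol15D h with ⟨-, hd, -⟩ | ⟨h1, -⟩
    · exact nomatch hd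
    · by_cases hin : ∀ j, r.input j = true
      · obtain ⟨j, c, hc, -⟩ := exists_crash_of_not_hearsOnes h1 hin
        exact .inr ⟨j, by simp [Faulty, hc]⟩
      · simpa using Or.inl hin

/-! ### Nice runs of the 1.5D protocol -/

theorem Nice.hearsOnes (hr : Nice r) (i : Fin n) : HearsOnes C r f i := fun j =>
  isOne_of_completesRound (hr.1 j) (completesRound_of_not_faulty (hr.2 j) 0)

theorem Nice.sent_one (hr : Nice r) (i j : Fin n) :
    sent (protocol15D n f C) r 1 i j = if IsSuccessor f i j then some Msg.allOnes else none := by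
  rw [sent_of_not_faulty _ (hr.2 i), protocol15D_state_one, if_pos (hr.hearsOnes i)]

theorem Nice.not_hearsHuh (hr : Nice r) (i : Fin n) : ¬ HearsHuh C r f i := by
  rintro ⟨j, hj⟩
  rw [hr.sent_one] at hj
  split_ifs at hj <;> simp [Msg.isHuh] at hj

theorem Nice.decides_iff (hr : Nice r) {i : Fin n} {m : ℕ} {d : ACDecision} :
    Decides (protocol15D n f C) r i m d ↔ m = 1 ∧ d = commit := by
  constructor
  · intro h
    rcases decides_protocol15D h with ⟨h1, h2, -⟩ | ⟨h1, -⟩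
    · exact ⟨h1, h2⟩
    · exact absurd (hr.hearsOnes i) h1
  · rintro ⟨rfl, rfl⟩
    refine ⟨?_, fun c hc => .inl (completesRound_of_not_faulty (hr.2 i) 1 c hc)⟩
    rw [protocol15D_state_one, if_pos (hr.hearsOnes i)]

theorem Nice.messageCount_protocol15D (hr : Nice r) (hfn : f < n) :
    messageCount (protocol15D n f C) r = ((n ^ 2 + n * f - n : ℕ) : ℕ∞) := by
  rw [← card_messageSlots (injective_successor hfn), ← Set.encard_coe_eq_coe_finsetCard]
  unfold messageCount
  congr 1
  ext ⟨m, i, j⟩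
  rw [Finset.mem_coe, mem_messageSlots]
  have hsucc : (∃ k : Fin f, (⟨((i : ℕ) + ((k : ℕ) + 1)) % n, Nat.mod_lt _ (by omega)⟩ : Fin n)
      = j) ↔ IsSuccessor f i j := by
    simp [IsSuccessor, Fin.ext_iff, eq_comm]
  rw [hsucc]
  change i ≠ j ∧ sent (protocol15D n f C) r m i j ≠ none ↔ _
  match m with
  | 0 =>
    rw [sent_of_not_faulty _ (hr.2 i), protocol15D_state_zero, if_pos (hr.1 i)]
    simp
  | 1 =>
    rw [hr.sent_one]
    simpa using fun h : IsSuccessor f i j => h.ne hfn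
  | m + 2 =>
    rw [sent_of_not_faulty _ (hr.2 i), protocol15D_state_add_two, if_neg (hr.not_hearsHuh i)]
    simp [Action.silent]

end

end SyncCrash

theorem mainTheorem8 (n f : ℕ) (hn : 2 < n) (hf : 1 ≤ f) (hfn : f < n) :
    -- suitable consensus subroutines exist
    (∃ (μ : Type u) (C : SyncCrash.Protocol n Bool μ Bool),
      SyncCrash.IsB1Consensus f (f - 1) C) ∧
    -- with any of them, 1.5D solves AC; its nice runs commit at time 1 with this message count
    (∀ (μ : Type u) (C : SyncCrash.Protocol n Bool μ Bool),
      SyncCrash.IsB1Consensus f (f - 1) C →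
        SyncCrash.SolvesAC f (SyncCrash.protocol15D n f C) ∧
        ∀ r : SyncCrash.Run n Bool, SyncCrash.Nice r →
          (∀ i m d, SyncCrash.Decides (SyncCrash.protocol15D n f C) r i m d ↔
            m = 1 ∧ d = SyncCrash.ACDecision.commit) ∧
          SyncCrash.messageCount (SyncCrash.protocol15D n f C) r =
            ((n ^ 2 + n * f - n : ℕ) : ℕ∞)) ∧
    -- for f > 1, no AC protocol that commits before time 2 in nice runs uses fewer messages
    (1 < f → ∀ (M : Type u) (P : SyncCrash.Protocol n Bool M SyncCrash.ACDecision),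
      SyncCrash.SolvesAC f P →
      (∀ r : SyncCrash.Run n Bool, SyncCrash.Nice r →
        ∀ i, ∃ m < 2, SyncCrash.Decides P r i m SyncCrash.ACDecision.commit) →
      ∀ r : SyncCrash.Run n Bool, SyncCrash.Nice r →
        ((n ^ 2 + n * f - n : ℕ) : ℕ∞) ≤ SyncCrash.messageCount P r) := by
  refine ⟨⟨PUnit, SyncCrash.floodOnes n (f - 1 + 1) PUnit.unit,
    SyncCrash.isB1Consensus_floodOnes n f (f - 1) _⟩, fun μ C hC => ?_,
    fun hf1 M P hP hc r hr => ?_⟩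
  · exact ⟨SyncCrash.solvesAC_protocol15D hfn hC,
      fun r hr => ⟨fun i m d => hr.decides_iff, hr.messageCount_protocol15D hfn⟩⟩
  · rw [hr.eq]
    exact SyncCrash.le_messageCount_of_solvesAC hn.le hf1 hfn hP
      (hc _ (SyncCrash.nice_niceRun n))
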